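/- Let $m\in\mathbb R$ and consider, in coordinates $(\eta,u,r,\theta,\phi)$, the metric $$g=d\eta^2+\eta^2\Big[-\Big(1-\frac{2m}{r}\Big)du^2-2\,du\,dr+r^2\big(d\theta^2+\sin^2\theta\,d\phi^2\big)\Big],$$ the warped product, with warping function $f(\eta)=\eta^2$, of a one-dimensional base $(d\eta^2)$ and the $4$-dimensional Schwarzschild metric in outgoing Eddington–Finkelstein coordinates, on any non-empty open set $U$ of coordinate space on which $\eta\neq 0$, $r\neq 0$ and $\sin\theta\neq 0$. Conventions, for dimension $n$ (here $n=5$): $$R_{abcd}=g_{ap}\big(\partial_d\Gamma^p_{bc}-\partial_c\Gamma^p_{bd}+\Gamma^q_{bc}\Gamma^p_{qd}-\Gamma^q_{bd}\Gamma^p_{qc}\big),\quad S_{ab}=g^{pq}R_{pabq},\quad \kappa=g^{ab}S_{ab},$$ $$C=R+\frac{\kappa}{2(n-1)(n-2)}\,g\wedge g-\frac1{n-2}\,g\wedge S,\quad (D\wedge E)_{abcd}=D_{ad}E_{bc}+D_{bc}E_{ad}-D_{ac}E_{bd}-D_{bd}E_{ac}.$$ For $(0,4)$-tensors $L,V$ and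 a symmetric $(0,2)$-tensor $N$ put $$(L\cdot V)_{ijklab}=-g^{pq}\big(L_{abip}V_{qjkl}+L_{abjp}V_{iqkl}+L_{abkp}V_{ijql}+L_{ablp}V_{ijkq}\big),$$ $$Q(N,V)_{ijklab}=N_{ai}V_{bjkl}+N_{aj}V_{ibkl}+N_{ak}V_{ijbl}+N_{al}V_{ijkb}-N_{bi}V_{ajkl}-N_{bj}V_{iakl}-N_{bk}V_{ijal}-N_{bl}V_{ijka}.$$ Then $g$ is a semi-Riemannian metric on $U$, and at every point of $U$ $$C\cdot R=\frac{m}{3r^3}\,Q(S,R)\qquad\text{and}\qquad C\cdot C=\frac{m}{3r^3}\,Q(S,C).$$ If $m\neq0$, then $C\cdot R\neq 0$ and $C\cdot C\neq 0$ at every point of $U$; in particular neither $C\cdot R=0$ nor $C\cdot C=0$ holds on $U$. So $(U,g)$ is properly Ricci generalized pseudosymmetric due to the Weyl tensor (that is, $C\cdot R=f\,Q(S,R)$ on $U$ for some smooth function $f$, while $C\cdot R=0$ fails), and it has a Ricci generalized pseudosymmetric Weyl tensor ($C\cdot C=f\,Q(S,C)$ on $U$ for some smooth function $f$), without having a semisymmetric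 Weyl tensor ($C\cdot C=0$). -/

import Mathlib

namespace CurvCond

open scoped ContDiff

noncomputable section

/-! Curvature tensors of a semi-Riemannian metric in local coordinates. A metric on a coordinate
domain is given by its matrix of components at every point of coordinate space. -/

/-- Coordinate space of dimension `n`. -/
abbrev Coord (n : ℕ) : Type := Fin n → ℝ

/-- The components `g_{ij}` of a (0,2) tensor field, as functions of the coordinates. -/
abbrev Field2 (n : ℕ) : Type := Coord n → Matrix (Fin n) (Fin n) ℝ

/-- The components of a (0,4) tensor at a point. -/
abbrev Tensor4 (n : ℕ) : Type := Fin n → Fin n → Fin n → Fin n → ℝ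

/-- The components of a (0,6) tensor at a point. -/
abbrev Tensor6 (n : ℕ) : Type := Fin n → Fin n → Fin n → Fin n → Fin n → Fin n → ℝ

/-- The partial derivative `∂F/∂x^k` at `x`. -/
def pderiv {n : ℕ} (k : Fin n) (F : Coord n → ℝ) (x : Coord n) : ℝ :=
  deriv (fun t => F (Function.update x k t)) (x k)

/-- `g` is a semi-Riemannian metric on the coordinate domain `U`: smooth, symmetric and
nondegenerate. -/
structure IsSemiRiemannianOn {n : ℕ} (g : Field2 n) (U : Set (Coord n)) : Prop where
  smooth : ∀ i j, ContDiffOn ℝ ∞ (fun x => g x i j) U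
  symm : ∀ x ∈ U, (g x).IsSymm
  nondegenerate : ∀ x ∈ U, (g x).det ≠ 0

/-- The Christoffel symbols `Γ^a_{bc}` of the Levi-Civita connection of `g`. -/
def christoffel {n : ℕ} (g : Field2 n) (a b c : Fin n) (x : Coord n) : ℝ :=
  (1 / 2) * ∑ d, (g x)⁻¹ a d *
    (pderiv b (fun y => g y d c) x + pderiv c (fun y => g y d b) x - pderiv d (fun y => g y b c) x)

/-- The Riemann curvature tensor
`R_{abcd} = g_{ap}(∂_d Γ^p_{bc} - ∂_c Γ^p_{bd} + Γ^q_{bc} Γ^p_{qd} - Γ^q_{bd} Γ^p_{qc})`. -/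
def riemann {n : ℕ} (g : Field2 n) (x : Coord n) : Tensor4 n := fun a b c d =>
  ∑ p, g x a p *
    (pderiv d (christoffel g p b c) x - pderiv c (christoffel g p b d) x +
      ∑ q, (christoffel g q b c x * christoffel g p q d x
        - christoffel g q b d x * christoffel g p q c x))

/-- The Ricci tensor `S_{ab} = g^{pq} R_{pabq}`. -/
def ricci {n : ℕ} (g : Field2 n) : Field2 n := fun x =>
  Matrix.of fun a b => ∑ p, ∑ q, (g x)⁻¹ p q * riemann g x p a b q

/-- The scalar curvature `κ = g^{ab} S_{ab}`. -/
def scalarCurv {n : ℕ} (g : Field2 n) (x : Coord n) : ℝ :=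
  ∑ a, ∑ b, (g x)⁻¹ a b * ricci g x a b

/-- The Kulkarni-Nomizu product `D ∧ E` of two (0,2) tensors. -/
def kulkarniNomizu {n : ℕ} (D E : Matrix (Fin n) (Fin n) ℝ) : Tensor4 n := fun a b c d =>
  D a d * E b c + D b c * E a d - D a c * E b d - D b d * E a c

/-- The Weyl conformal curvature tensor
`C = R + κ / (2(n-1)(n-2)) g ∧ g - 1 / (n-2) g ∧ S`. -/
def weyl {n : ℕ} (g : Field2 n) (x : Coord n) : Tensor4 n := fun a b c d =>
  riemann g x a b c d
    + scalarCurv g x / (2 * ((n : ℝ) - 1) * ((n : ℝ) - 2)) *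
        kulkarniNomizu (g x) (g x) a b c d
    - 1 / ((n : ℝ) - 2) * kulkarniNomizu (g x) (ricci g x) a b c d

/-- The tensor `L · V` of (0,4) tensors `L` and `V`, where `G` is the metric at the point:
`(L · V)_{ijklab} = -G^{pq} (L_{abip} V_{qjkl} + L_{abjp} V_{iqkl} + L_{abkp} V_{ijql} +
L_{ablp} V_{ijkq})`. It is the result of letting the endomorphism `𝓛(∂_a, ∂_b)`, given by
`G(𝓛(∂_a, ∂_b) X, Y) = L(∂_a, ∂_b, X, Y)`, act on `V` as a derivation. -/
def curvAction {n : ℕ} (G : Matrix (Fin n) (Fin n) ℝ) (L V : Tensor4 n) : Tensor6 n :=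
  fun i j k l a b =>
    -∑ p, ∑ q, G⁻¹ p q *
      (L a b i p * V q j k l + L a b j p * V i q k l + L a b k p * V i j q l
        + L a b l p * V i j k q)

/-- The Tachibana tensor `Q(N, V)` of a symmetric (0,2) tensor `N` and a (0,4) tensor `V`: the
result of letting the endomorphism `∂_a ∧_N ∂_b`, given by
`(∂_a ∧_N ∂_b) X = N(∂_b, X) ∂_a - N(∂_a, X) ∂_b`, act on `V` as a derivation, that is
`Q(N, V)(X₁, X₂, X₃, X₄, ∂_a, ∂_b) = -V((∂_a ∧_N ∂_b) X₁, X₂, X₃, X₄) - ⋯`. -/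
def tachibana {n : ℕ} (N : Matrix (Fin n) (Fin n) ℝ) (V : Tensor4 n) : Tensor6 n :=
  fun i j k l a b =>
    (N a i * V b j k l + N a j * V i b k l + N a k * V i j b l + N a l * V i j k b)
      - (N b i * V a j k l + N b j * V i a k l + N b k * V i j a l + N b l * V i j k a)

/-- `C · R` at `x`. -/
def weylDotRiemann {n : ℕ} (g : Field2 n) (x : Coord n) : Tensor6 n :=
  curvAction (g x) (weyl g x) (riemann g x)

/-- `C · C` at `x`. -/
def weylDotWeyl {n : ℕ} (g : Field2 n) (x : Coord n) : Tensor6 n :=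
  curvAction (g x) (weyl g x) (weyl g x)

/-- Semisymmetric due to the Weyl tensor: `C · R = 0` on `U`. -/
def IsSemisymmetricDueToWeyl {n : ℕ} (g : Field2 n) (U : Set (Coord n)) : Prop :=
  ∀ x ∈ U, weylDotRiemann g x = 0

/-- Semisymmetric Weyl tensor: `C · C = 0` on `U`. -/
def HasSemisymmetricWeyl {n : ℕ} (g : Field2 n) (U : Set (Coord n)) : Prop :=
  ∀ x ∈ U, weylDotWeyl g x = 0

/-- Ricci generalized pseudosymmetric due to the Weyl tensor: `C · R = f Q(S, R)` on `U` for a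
smooth function `f`. -/
def IsRicciGenPseudosymmetricDueToWeyl {n : ℕ} (g : Field2 n) (U : Set (Coord n)) : Prop :=
  ∃ f : Coord n → ℝ, ContDiffOn ℝ ∞ f U ∧
    ∀ x ∈ U, weylDotRiemann g x = f x • tachibana (ricci g x) (riemann g x)

/-- Properly Ricci generalized pseudosymmetric due to the Weyl tensor: in addition `C · R = 0`
fails. -/
def IsProperlyRicciGenPseudosymmetricDueToWeyl {n : ℕ} (g : Field2 n) (U : Set (Coord n)) : Prop :=
  IsRicciGenPseudosymmetricDueToWeyl g U ∧ ¬ IsSemisymmetricDueToWeyl g U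

/-- Ricci generalized pseudosymmetric Weyl tensor: `C · C = f Q(S, C)` on `U` for a smooth
function `f`. -/
def HasRicciGenPseudosymmetricWeyl {n : ℕ} (g : Field2 n) (U : Set (Coord n)) : Prop :=
  ∃ f : Coord n → ℝ, ContDiffOn ℝ ∞ f U ∧
    ∀ x ∈ U, weylDotWeyl g x = f x • tachibana (ricci g x) (weyl g x)

/-- The Schwarzschild metric with parameter `m` in outgoing Eddington-Finkelstein coordinates
`(u, r, θ, φ)`: `-(1 - 2m/r) du² - 2 du dr + r² (dθ² + sin² θ dφ²)`. -/
def schwarzschild (m : ℝ) : Field2 4 := fun y =>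
  !![-(1 - 2 * m / y 1), -1, 0, 0;
     -1, 0, 0, 0;
     0, 0, (y 1) ^ 2, 0;
     0, 0, 0, (y 1) ^ 2 * Real.sin (y 2) ^ 2]

/-- The warped product metric `dη² + f(η) h` over a one-dimensional base with coordinate
`η = x 0`, with fibre metric `h` in the remaining coordinates. -/
def warpedMetric {k : ℕ} (f : ℝ → ℝ) (h : Field2 k) : Field2 (k + 1) := fun x =>
  Matrix.of (Matrix.vecCons (Matrix.vecCons 1 0)
    (fun i => Matrix.vecCons 0 (fun j => f (x 0) * h (fun s => x s.succ) i j)))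

/-- The metric `dη² + η² · (Schwarzschild metric)` in coordinates `(η, u, r, θ, φ)`. -/
def coneSchwarzschild (m : ℝ) : Field2 5 :=
  warpedMetric (fun η => η ^ 2) (schwarzschild m)

theorem coneSchwarzschild_eq (m : ℝ) (x : Coord 5) :
    coneSchwarzschild m x =
      !![1, 0, 0, 0, 0;
         0, x 0 ^ 2 * -(1 - 2 * m / x 2), x 0 ^ 2 * -1, 0, 0;
         0, x 0 ^ 2 * -1, 0, 0, 0;
         0, 0, 0, x 0 ^ 2 * x 2 ^ 2, 0;
         0, 0, 0, 0, x 0 ^ 2 * (x 2 ^ 2 * Real.sin (x 3) ^ 2)] := by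
  ext i j
  fin_cases i <;> fin_cases j <;> simp [coneSchwarzschild, warpedMetric, schwarzschild]

/-- The points `(η, u, r, θ, φ)` at which the coordinate expression of the metric is regular. -/
def regularDomain : Set (Coord 5) :=
  {x | x 0 ≠ 0 ∧ x 2 ≠ 0 ∧ Real.sin (x 3) ≠ 0}

end

end CurvCond

namespace CurvCond

open scoped ContDiff

noncomputable section

/-! Write `D` and `E` for the `(u, r)` and `(θ, φ)` blocks of the metric, so that `g = dη² + H` with
`H = D + E`. The metric is a cone over a Ricci-flat type D fibre. Hence its curvature has no `η`
components and equals `w T - (1 / (2 η²)) H ∧ H`, where `T = typeD D E` and `w = m / (r³ η²)`. Since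
`T` is trace-free, `S = -(3 / η²) H`, and the constant curvature part cancels in the Weyl tensor: `C
= w T`.

The rest is algebra. `T` takes the value 2 on planes inside `D` or inside `E` and -1 on mixed
planes. If `∂_a`, `∂_b` lie in the same block, both `T(∂_a, ∂_b)` and `∂_a ∧_H ∂_b` rotate that
block and annihilate `T`. If they lie in different blocks, `T(∂_a, ∂_b)` is minus the rotation
generated by `H`. Thus `T · T = -Q(H, T)` (`curvAction_typeD`). Moreover `T · (H ∧ H) = 0`
(`curvAction_typeD_kulkarniNomizu`) and `Q(H, H ∧ H) = 0` (`tachibana_kulkarniNomizu_self`).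
Therefore `C · R = C · C = -w² Q(H, T)` and `Q(S, R) = Q(S, C) = -(3 w / η²) Q(H, T)`, with quotient
`w η² / 3 = m / (3 r³)`. One explicit component shows that `Q(H, T)` vanishes nowhere.

The curvature formula is found by computing all Christoffel symbols and their derivatives
(`riemann_coneSchwarzschild`). -/

/-- The type D combination `D ∧ D + E ∧ E - D ∧ E`. -/
def typeD {n : ℕ} (D E : Matrix (Fin n) (Fin n) ℝ) : Tensor4 n := fun a b c d =>
  kulkarniNomizu D D a b c d + kulkarniNomizu E E a b c d - kulkarniNomizu D E a b c d

/-! ### Algebra of type D tensors built from two orthogonal blocks. -/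

section Algebra

variable {n : ℕ} {G D E : Matrix (Fin n) (Fin n) ℝ}

theorem sum_contract {X Y Z : Matrix (Fin n) (Fin n) ℝ} (h : X * G⁻¹ * Y = Z) (i j : Fin n) :
    ∑ p, ∑ q, G⁻¹ p q * (X i p * Y q j) = Z i j := by
  rw [← h, Matrix.mul_apply, Finset.sum_comm]
  refine Finset.sum_congr rfl fun q _ => ?_
  rw [Matrix.mul_apply, Finset.sum_mul]
  exact Finset.sum_congr rfl fun p _ => by ring

/-- Two complementary orthogonal block forms absorb `G⁻¹` under contraction. -/
structure IsBlockPair (G D E : Matrix (Fin n) (Fin n) ℝ) : Prop where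
  symm_left : ∀ i j, D i j = D j i
  symm_right : ∀ i j, E i j = E j i
  left_left : D * G⁻¹ * D = D
  left_right : D * G⁻¹ * E = 0
  right_left : E * G⁻¹ * D = 0
  right_right : E * G⁻¹ * E = E

/-- The contraction of `typeD D E` in the last slot with a covector-valued slot of another tensor
given by `v`, in terms of the contractions of `D` and `E` with `v`. -/
theorem sum_typeD_mul (a b i : Fin n) (v : Fin n → ℝ) :
    ∑ p, ∑ q, G⁻¹ p q * (typeD D E a b i p * v q) =
      2 * D b i * (∑ p, ∑ q, G⁻¹ p q * (D a p * v q))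
      - 2 * D a i * (∑ p, ∑ q, G⁻¹ p q * (D b p * v q))
      + 2 * E b i * (∑ p, ∑ q, G⁻¹ p q * (E a p * v q))
      - 2 * E a i * (∑ p, ∑ q, G⁻¹ p q * (E b p * v q))
      - E b i * (∑ p, ∑ q, G⁻¹ p q * (D a p * v q))
      + E a i * (∑ p, ∑ q, G⁻¹ p q * (D b p * v q))
      - D b i * (∑ p, ∑ q, G⁻¹ p q * (E a p * v q))
      + D a i * (∑ p, ∑ q, G⁻¹ p q * (E b p * v q)) := by
  simp only [Finset.mul_sum, ← Finset.sum_add_distrib, ← Finset.sum_sub_distrib]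
  refine Finset.sum_congr rfl fun p _ => Finset.sum_congr rfl fun q _ => ?_
  simp only [typeD, kulkarniNomizu]
  ring

theorem curvAction_eq (L V : Tensor4 n) (i j k l a b : Fin n) :
    curvAction G L V i j k l a b =
      -((∑ p, ∑ q, G⁻¹ p q * (L a b i p * V q j k l))
        + (∑ p, ∑ q, G⁻¹ p q * (L a b j p * V i q k l))
        + (∑ p, ∑ q, G⁻¹ p q * (L a b k p * V i j q l))
        + (∑ p, ∑ q, G⁻¹ p q * (L a b l p * V i j k q))) := by
  simp only [curvAction, ← Finset.sum_add_distrib]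
  congr 1
  refine Finset.sum_congr rfl fun p _ => Finset.sum_congr rfl fun q _ => ?_
  ring

/-- Contraction is linear in the first slot of the Kulkarni-Nomizu product, so it only replaces `A`
and `B` there by their contractions with `X`. -/
theorem sum_mul_kulkarniNomizu_fst {X A B A' B' : Matrix (Fin n) (Fin n) ℝ}
    (hA : X * G⁻¹ * A = A') (hB : X * G⁻¹ * B = B') (a j k l : Fin n) :
    ∑ p, ∑ q, G⁻¹ p q * (X a p * kulkarniNomizu A B q j k l) =
      A' a l * B j k + A j k * B' a l - A' a k * B j l - A j l * B' a k := by
  simp only [← sum_contract hA, ← sum_contract hB, Finset.mul_sum, Finset.sum_mul,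
    ← Finset.sum_add_distrib, ← Finset.sum_sub_distrib]
  refine Finset.sum_congr rfl fun p _ => Finset.sum_congr rfl fun q _ => ?_
  simp only [kulkarniNomizu]
  ring

theorem kulkarniNomizu_swap_left (A B : Matrix (Fin n) (Fin n) ℝ) (i j k l : Fin n) :
    kulkarniNomizu A B i j k l = -kulkarniNomizu A B j i k l := by
  simp only [kulkarniNomizu]; ring

theorem kulkarniNomizu_swap_pairs {A B : Matrix (Fin n) (Fin n) ℝ} (hA : ∀ i j, A i j = A j i)
    (hB : ∀ i j, B i j = B j i) (i j k l : Fin n) :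
    kulkarniNomizu A B i j k l = kulkarniNomizu A B k l i j := by
  simp only [kulkarniNomizu, hA k, hB k, hA l, hB l]; ring

theorem typeD_swap_left (i j k l : Fin n) : typeD D E i j k l = -typeD D E j i k l := by
  simp only [typeD, kulkarniNomizu]; ring

theorem typeD_swap_pairs (h : IsBlockPair G D E) (i j k l : Fin n) :
    typeD D E i j k l = typeD D E k l i j := by
  simp only [typeD, kulkarniNomizu_swap_pairs h.symm_left h.symm_left i,
    kulkarniNomizu_swap_pairs h.symm_right h.symm_right i,
    kulkarniNomizu_swap_pairs h.symm_left h.symm_right i]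

theorem sum_left_typeD (h : IsBlockPair G D E) (a j k l : Fin n) :
    ∑ p, ∑ q, G⁻¹ p q * (D a p * typeD D E q j k l) =
      2 * (D a l * D j k - D a k * D j l) - D a l * E j k + D a k * E j l := by
  have h1 := sum_mul_kulkarniNomizu_fst h.left_left h.left_left a j k l
  have h2 := sum_mul_kulkarniNomizu_fst h.left_right h.left_right a j k l
  have h3 := sum_mul_kulkarniNomizu_fst h.left_left h.left_right a j k l
  simp only [Matrix.zero_apply] at h1 h2 h3
  simp only [typeD, mul_add, mul_sub, Finset.sum_add_distrib, Finset.sum_sub_distrib, h1, h2, h3]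
  ring

theorem sum_right_typeD (h : IsBlockPair G D E) (a j k l : Fin n) :
    ∑ p, ∑ q, G⁻¹ p q * (E a p * typeD D E q j k l) =
      2 * (E a l * E j k - E a k * E j l) - E a l * D j k + E a k * D j l := by
  have h1 := sum_mul_kulkarniNomizu_fst h.right_left h.right_left a j k l
  have h2 := sum_mul_kulkarniNomizu_fst h.right_right h.right_right a j k l
  have h3 := sum_mul_kulkarniNomizu_fst h.right_left h.right_right a j k l
  simp only [Matrix.zero_apply] at h1 h2 h3
  simp only [typeD, mul_add, mul_sub, Finset.sum_add_distrib, Finset.sum_sub_distrib, h1, h2, h3]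
  ring

/-- The contraction of two type D tensors. -/
theorem sum_typeD_typeD (h : IsBlockPair G D E) (a b i j k l : Fin n) :
    ∑ p, ∑ q, G⁻¹ p q * (typeD D E a b i p * typeD D E q j k l) =
      (2 * D b i - E b i) * (2 * (D a l * D j k - D a k * D j l) - D a l * E j k + D a k * E j l)
      - (2 * D a i - E a i) * (2 * (D b l * D j k - D b k * D j l) - D b l * E j k + D b k * E j l)
      + (2 * E b i - D b i) * (2 * (E a l * E j k - E a k * E j l) - E a l * D j k + E a k * D j l)
      - (2 * E a i - D a i) *
        (2 * (E b l * E j k - E b k * E j l) - E b l * D j k + E b k * D j l) := by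
  rw [sum_typeD_mul, sum_left_typeD h, sum_left_typeD h, sum_right_typeD h, sum_right_typeD h]
  ring

/-- A type D tensor acts on itself as a Tachibana tensor of the sum of its blocks. -/
theorem curvAction_typeD (h : IsBlockPair G D E) :
    curvAction G (typeD D E) (typeD D E) = -tachibana (D + E) (typeD D E) := by
  ext i j k l a b
  rw [curvAction_eq]
  -- The curvature symmetries bring the contracted index to the first slot, so that
  -- `sum_typeD_typeD` covers all four terms.
  have e2 : ∀ q, typeD D E i q k l = -typeD D E q i k l := fun q => typeD_swap_left ..
  have e3 : ∀ q, typeD D E i j q l = typeD D E q l i j := fun q => typeD_swap_pairs h ..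
  have e4 : ∀ q, typeD D E i j k q = -typeD D E q k i j := fun q => by
    rw [typeD_swap_pairs h, typeD_swap_left]
  simp only [e2, e3, e4, mul_neg, Finset.sum_neg_distrib, sum_typeD_typeD h]
  simp only [Pi.neg_apply, tachibana, Matrix.add_apply, typeD, kulkarniNomizu]
  -- Each symmetric pair of indices gets one fixed order, after which the identity is polynomial.
  simp only [h.symm_left _ a, h.symm_right _ a]
  simp only [h.symm_left _ b, h.symm_right _ b, h.symm_left k i, h.symm_left l i,
    h.symm_left k j, h.symm_left l j, h.symm_right k i, h.symm_right l i, h.symm_right k j,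
    h.symm_right l j]
  ring

/-- On the span of the blocks `D + E` acts as the metric, so contracting with it merely renames an
index of `typeD D E`. -/
theorem sum_typeD_kulkarniNomizu (h : IsBlockPair G D E) (a b i j k l : Fin n) :
    ∑ p, ∑ q, G⁻¹ p q * (typeD D E a b i p * kulkarniNomizu (D + E) (D + E) q j k l) =
      2 * (typeD D E a b i l * (D + E) j k - typeD D E a b i k * (D + E) j l) := by
  have hD : D * G⁻¹ * (D + E) = D := by rw [mul_add, h.left_left, h.left_right, add_zero]
  have hE : E * G⁻¹ * (D + E) = E := by rw [mul_add, h.right_left, h.right_right, zero_add]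
  rw [sum_typeD_mul]
  simp only [sum_mul_kulkarniNomizu_fst hD hD, sum_mul_kulkarniNomizu_fst hE hE]
  simp only [typeD, kulkarniNomizu]
  ring

/-- A type D tensor annihilates the constant curvature tensor of the sum of its blocks. -/
theorem curvAction_typeD_kulkarniNomizu (h : IsBlockPair G D E) :
    curvAction G (typeD D E) (kulkarniNomizu (D + E) (D + E)) = 0 := by
  have hs : ∀ i j, (D + E) i j = (D + E) j i := fun i j => by
    simp only [Matrix.add_apply, h.symm_left i j, h.symm_right i j]
  -- Skewness in the last pair says that the endomorphisms given by `typeD D E` are infinitesimal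
  -- isometries of `D + E`; this makes the terms cancel in pairs.
  have skew : ∀ a b i j, typeD D E a b i j = -typeD D E a b j i := fun a b i j => by
    simp only [typeD, kulkarniNomizu]; ring
  ext i j k l a b
  rw [curvAction_eq]
  have e2 : ∀ q, kulkarniNomizu (D + E) (D + E) i q k l =
      -kulkarniNomizu (D + E) (D + E) q i k l := fun q => kulkarniNomizu_swap_left ..
  have e3 : ∀ q, kulkarniNomizu (D + E) (D + E) i j q l =
      kulkarniNomizu (D + E) (D + E) q l i j := fun q => kulkarniNomizu_swap_pairs hs hs ..
  have e4 : ∀ q, kulkarniNomizu (D + E) (D + E) i j k q =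
      -kulkarniNomizu (D + E) (D + E) q k i j := fun q => by
    rw [kulkarniNomizu_swap_pairs hs hs, kulkarniNomizu_swap_left]
  simp only [e2, e3, e4, mul_neg, Finset.sum_neg_distrib, sum_typeD_kulkarniNomizu h]
  rw [skew a b k j, skew a b l j, skew a b k i, skew a b l i, hs k i, hs k j, hs l i, hs l j]
  simp only [Pi.zero_apply]
  ring

end Algebra

/-! ### Linearity of the two operations. -/

theorem curvAction_smul_left {n : ℕ} (G : Matrix (Fin n) (Fin n) ℝ) (c : ℝ) (L V : Tensor4 n) :
    curvAction G (c • L) V = c • curvAction G L V := by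
  ext i j k l a b
  simp only [curvAction, Pi.smul_apply, smul_eq_mul, mul_neg, Finset.mul_sum]
  congr 1
  exact Finset.sum_congr rfl fun p _ => Finset.sum_congr rfl fun q _ => by ring

theorem curvAction_smul_right {n : ℕ} (G : Matrix (Fin n) (Fin n) ℝ) (c : ℝ) (L V : Tensor4 n) :
    curvAction G L (c • V) = c • curvAction G L V := by
  ext i j k l a b
  simp only [curvAction, Pi.smul_apply, smul_eq_mul, mul_neg, Finset.mul_sum]
  congr 1
  exact Finset.sum_congr rfl fun p _ => Finset.sum_congr rfl fun q _ => by ring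

theorem curvAction_sub_right {n : ℕ} (G : Matrix (Fin n) (Fin n) ℝ) (L V W : Tensor4 n) :
    curvAction G L (V - W) = curvAction G L V - curvAction G L W := by
  ext i j k l a b
  simp only [curvAction, Pi.sub_apply, sub_neg_eq_add, neg_add_eq_sub,
    ← Finset.sum_sub_distrib, ← Finset.sum_neg_distrib]
  exact Finset.sum_congr rfl fun p _ => Finset.sum_congr rfl fun q _ => by ring

theorem tachibana_smul_left {n : ℕ} (c : ℝ) (N : Matrix (Fin n) (Fin n) ℝ) (V : Tensor4 n) :
    tachibana (c • N) V = c • tachibana N V := by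
  ext i j k l a b
  simp only [tachibana, Matrix.smul_apply, Pi.smul_apply, smul_eq_mul]
  ring

theorem tachibana_smul_right {n : ℕ} (c : ℝ) (N : Matrix (Fin n) (Fin n) ℝ) (V : Tensor4 n) :
    tachibana N (c • V) = c • tachibana N V := by
  ext i j k l a b
  simp only [tachibana, Pi.smul_apply, smul_eq_mul]
  ring

theorem tachibana_sub_right {n : ℕ} (N : Matrix (Fin n) (Fin n) ℝ) (V W : Tensor4 n) :
    tachibana N (V - W) = tachibana N V - tachibana N W := by
  ext i j k l a b
  simp only [tachibana, Pi.sub_apply]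
  ring

/-- The endomorphism `∂_a ∧_N ∂_b` is skew with respect to `N`, so as a derivation it annihilates
everything built from `N` alone. -/
theorem tachibana_kulkarniNomizu_self {n : ℕ} {N : Matrix (Fin n) (Fin n) ℝ}
    (hN : ∀ i j, N i j = N j i) : tachibana N (kulkarniNomizu N N) = 0 := by
  ext i j k l a b
  simp only [tachibana, kulkarniNomizu, Pi.zero_apply, hN _ a]
  simp only [hN _ b]
  ring

/-! ### Inverse metric, Christoffel symbols and their derivatives. -/

/-- Case distinction on an index in `Fin 5`, with numerals for the five values. -/
@[elab_as_elim]
theorem fin_five_cases {P : Fin 5 → Prop} (i : Fin 5) (h0 : P 0) (h1 : P 1) (h2 : P 2) (h3 : P 3)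
    (h4 : P 4) : P i := by
  fin_cases i <;> assumption

/-- The components of the inverse of the metric `coneSchwarzschild m`. -/
def coneInv (m : ℝ) : Field2 5 := fun x =>
  !![1, 0, 0, 0, 0;
     0, 0, -(1 / x 0 ^ 2), 0, 0;
     0, -(1 / x 0 ^ 2), 1 / x 0 ^ 2 * (1 - 2 * m / x 2), 0, 0;
     0, 0, 0, 1 / (x 0 ^ 2 * x 2 ^ 2), 0;
     0, 0, 0, 0, 1 / (x 0 ^ 2 * (x 2 ^ 2 * Real.sin (x 3) ^ 2))]

theorem coneSchwarzschild_mul_coneInv (m : ℝ) {x : Coord 5} (hx : x ∈ regularDomain) :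
    coneSchwarzschild m x * coneInv m x = 1 := by
  obtain ⟨h0, h2, h3⟩ := hx
  rw [coneSchwarzschild_eq, coneInv]
  ext i j
  fin_cases i <;> fin_cases j <;> simp [Matrix.mul_apply, Fin.sum_univ_five] <;> field_simp <;> ring

theorem coneSchwarzschild_inv (m : ℝ) {x : Coord 5} (hx : x ∈ regularDomain) :
    (coneSchwarzschild m x)⁻¹ = coneInv m x :=
  Matrix.inv_eq_right_inv (coneSchwarzschild_mul_coneInv m hx)

/-- The partial derivatives `∂_k g_{ij}` of the metric `coneSchwarzschild m` in terms of `η`, `r`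
and `θ`. -/
def coneDeriv (m : ℝ) (k : Fin 5) (η r θ : ℝ) : Matrix (Fin 5) (Fin 5) ℝ :=
  match k with
  | 0 => !![0, 0, 0, 0, 0;
       0, -(2 * η * (1 - 2 * m / r)), -(2 * η), 0, 0;
       0, -(2 * η), 0, 0, 0;
       0, 0, 0, 2 * η * r ^ 2, 0;
       0, 0, 0, 0, 2 * η * (r ^ 2 * Real.sin θ ^ 2)]
  | 2 => !![0, 0, 0, 0, 0;
       0, -(η ^ 2 * (2 * m / r ^ 2)), 0, 0, 0;
       0, 0, 0, 0, 0;
       0, 0, 0, η ^ 2 * (2 * r), 0;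
       0, 0, 0, 0, η ^ 2 * (2 * r * Real.sin θ ^ 2)]
  | 3 => !![0, 0, 0, 0, 0;
       0, 0, 0, 0, 0;
       0, 0, 0, 0, 0;
       0, 0, 0, 0, 0;
       0, 0, 0, 0, η ^ 2 * (r ^ 2 * (2 * Real.sin θ * Real.cos θ))]
  | 1 => 0
  | 4 => 0

/-- The components involve only `η`, `r` and `θ`, so the derivatives along `u` and `φ` vanish. No
differentiability is needed. -/
theorem pderiv_radial (f : ℝ → ℝ → ℝ → ℝ) (k : Fin 5) (x : Coord 5) :
    pderiv k (fun y => f (y 0) (y 2) (y 3)) x =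
      ![deriv (fun t => f t (x 2) (x 3)) (x 0), 0, deriv (fun t => f (x 0) t (x 3)) (x 2),
        deriv (fun t => f (x 0) (x 2) t) (x 3), 0] k := by
  fin_cases k <;> simp [pderiv]

/-- Regularity is not needed: at `r = 0` the value of `deriv` for `2 * m / r` and the quotient `2 *
m / r ^ 2` are both 0 by convention. -/
theorem pderiv_coneSchwarzschild (m : ℝ) (k i j : Fin 5) (x : Coord 5) :
    pderiv k (fun y => coneSchwarzschild m y i j) x = coneDeriv m k (x 0) (x 2) (x 3) i j := by
  simp only [coneSchwarzschild_eq]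
  refine (pderiv_radial (fun η r θ => (!![1, 0, 0, 0, 0;
         0, η ^ 2 * -(1 - 2 * m / r), η ^ 2 * -1, 0, 0;
         0, η ^ 2 * -1, 0, 0, 0;
         0, 0, 0, η ^ 2 * r ^ 2, 0;
         0, 0, 0, 0, η ^ 2 * (r ^ 2 * Real.sin θ ^ 2)] : Matrix (Fin 5) (Fin 5) ℝ) i j) k x).trans ?_
  cases i using fin_five_cases <;> cases j using fin_five_cases <;>
    cases k using fin_five_cases <;>
    dsimp only [coneDeriv, Matrix.of_apply, Matrix.cons_val', Matrix.cons_val_fin_one,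
      Matrix.cons_val] <;>
    (try dsimp only [Matrix.cons_val]) <;>
    simp <;> ring

/-- The Christoffel symbols `Γ^a_{bc}` of the metric `coneSchwarzschild m` in terms of `η`, `r`
and `θ`. -/
def coneGamma (m : ℝ) (a : Fin 5) (η r θ : ℝ) : Matrix (Fin 5) (Fin 5) ℝ :=
  match a with
  | 0 => !![0, 0, 0, 0, 0;
       0, η * (1 - 2 * m / r), η, 0, 0;
       0, η, 0, 0, 0;
       0, 0, 0, -(η * r ^ 2), 0;
       0, 0, 0, 0, -(η * r ^ 2 * Real.sin θ ^ 2)]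
  | 1 => !![0, 1 / η, 0, 0, 0;
       1 / η, -(m / r ^ 2), 0, 0, 0;
       0, 0, 0, 0, 0;
       0, 0, 0, r, 0;
       0, 0, 0, 0, r * Real.sin θ ^ 2]
  | 2 => !![0, 0, 1 / η, 0, 0;
       0, m / r ^ 2 - 2 * m ^ 2 / r ^ 3, m / r ^ 2, 0, 0;
       1 / η, m / r ^ 2, 0, 0, 0;
       0, 0, 0, 2 * m - r, 0;
       0, 0, 0, 0, (2 * m - r) * Real.sin θ ^ 2]
  | 3 => !![0, 0, 0, 1 / η, 0;
       0, 0, 0, 0, 0;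
       0, 0, 0, 1 / r, 0;
       1 / η, 0, 1 / r, 0, 0;
       0, 0, 0, 0, -(Real.sin θ * Real.cos θ)]
  | 4 => !![0, 0, 0, 0, 1 / η;
       0, 0, 0, 0, 0;
       0, 0, 0, 0, 1 / r;
       0, 0, 0, 0, Real.cos θ / Real.sin θ;
       1 / η, 0, 1 / r, Real.cos θ / Real.sin θ, 0]

theorem christoffel_coneSchwarzschild (m : ℝ) (a b c : Fin 5) {x : Coord 5}
    (hx : x ∈ regularDomain) :
    christoffel (coneSchwarzschild m) a b c x = coneGamma m a (x 0) (x 2) (x 3) b c := by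
  simp only [christoffel, coneSchwarzschild_inv m hx, pderiv_coneSchwarzschild,
    Fin.sum_univ_five, coneInv]
  obtain ⟨h0, h2, h3⟩ := hx
  cases a using fin_five_cases <;> cases b using fin_five_cases <;>
    cases c using fin_five_cases <;>
    dsimp only [coneGamma, coneDeriv, Matrix.of_apply, Matrix.cons_val', Matrix.cons_val_fin_one,
      Matrix.cons_val, Matrix.zero_apply] <;>
    dsimp only [Matrix.cons_val] <;>
    simp only [add_zero, zero_add, sub_zero, zero_sub, mul_zero, zero_mul] <;>
    field_simp <;> ring

/-- The partial derivatives `∂_k Γ^a_{bc}` for the metric `coneSchwarzschild m` in terms of `η`,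
`r` and `θ`. -/
def coneGammaDeriv (m : ℝ) (k a : Fin 5) (η r θ : ℝ) : Matrix (Fin 5) (Fin 5) ℝ :=
  match k, a with
  | 0, 0 => !![0, 0, 0, 0, 0;
       0, 1 - 2 * m / r, 1, 0, 0;
       0, 1, 0, 0, 0;
       0, 0, 0, -r ^ 2, 0;
       0, 0, 0, 0, -(r ^ 2 * Real.sin θ ^ 2)]
  | 0, 1 => !![0, -(η ^ 2)⁻¹, 0, 0, 0;
       -(η ^ 2)⁻¹, 0, 0, 0, 0;
       0, 0, 0, 0, 0;
       0, 0, 0, 0, 0;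
       0, 0, 0, 0, 0]
  | 0, 2 => !![0, 0, -(η ^ 2)⁻¹, 0, 0;
       0, 0, 0, 0, 0;
       -(η ^ 2)⁻¹, 0, 0, 0, 0;
       0, 0, 0, 0, 0;
       0, 0, 0, 0, 0]
  | 0, 3 => !![0, 0, 0, -(η ^ 2)⁻¹, 0;
       0, 0, 0, 0, 0;
       0, 0, 0, 0, 0;
       -(η ^ 2)⁻¹, 0, 0, 0, 0;
       0, 0, 0, 0, 0]
  | 0, 4 => !![0, 0, 0, 0, -(η ^ 2)⁻¹;
       0, 0, 0, 0, 0;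
       0, 0, 0, 0, 0;
       0, 0, 0, 0, 0;
       -(η ^ 2)⁻¹, 0, 0, 0, 0]
  | 2, 0 => !![0, 0, 0, 0, 0;
       0, η * (2 * m / r ^ 2), 0, 0, 0;
       0, 0, 0, 0, 0;
       0, 0, 0, -(η * (2 * r)), 0;
       0, 0, 0, 0, -(η * (2 * r) * Real.sin θ ^ 2)]
  | 2, 1 => !![0, 0, 0, 0, 0;
       0, 2 * m / r ^ 3, 0, 0, 0;
       0, 0, 0, 0, 0;
       0, 0, 0, 1, 0;
       0, 0, 0, 0, Real.sin θ ^ 2]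
  | 2, 2 => !![0, 0, 0, 0, 0;
       0, -(2 * m / r ^ 3) + 6 * m ^ 2 / r ^ 4, -(2 * m / r ^ 3), 0, 0;
       0, -(2 * m / r ^ 3), 0, 0, 0;
       0, 0, 0, -1, 0;
       0, 0, 0, 0, -Real.sin θ ^ 2]
  | 2, 3 => !![0, 0, 0, 0, 0;
       0, 0, 0, 0, 0;
       0, 0, 0, -(r ^ 2)⁻¹, 0;
       0, 0, -(r ^ 2)⁻¹, 0, 0;
       0, 0, 0, 0, 0]
  | 2, 4 => !![0, 0, 0, 0, 0;
       0, 0, 0, 0, 0;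
       0, 0, 0, 0, -(r ^ 2)⁻¹;
       0, 0, 0, 0, 0;
       0, 0, -(r ^ 2)⁻¹, 0, 0]
  | 3, 0 => !![0, 0, 0, 0, 0;
       0, 0, 0, 0, 0;
       0, 0, 0, 0, 0;
       0, 0, 0, 0, 0;
       0, 0, 0, 0, -(η * r ^ 2 * (2 * Real.sin θ * Real.cos θ))]
  | 3, 1 => !![0, 0, 0, 0, 0;
       0, 0, 0, 0, 0;
       0, 0, 0, 0, 0;
       0, 0, 0, 0, 0;
       0, 0, 0, 0, r * (2 * Real.sin θ * Real.cos θ)]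
  | 3, 2 => !![0, 0, 0, 0, 0;
       0, 0, 0, 0, 0;
       0, 0, 0, 0, 0;
       0, 0, 0, 0, 0;
       0, 0, 0, 0, (2 * m - r) * (2 * Real.sin θ * Real.cos θ)]
  | 3, 3 => !![0, 0, 0, 0, 0;
       0, 0, 0, 0, 0;
       0, 0, 0, 0, 0;
       0, 0, 0, 0, 0;
       0, 0, 0, 0, Real.sin θ ^ 2 - Real.cos θ ^ 2]
  | 3, 4 => !![0, 0, 0, 0, 0;
       0, 0, 0, 0, 0;
       0, 0, 0, 0, 0;
       0, 0, 0, 0, -(Real.sin θ ^ 2)⁻¹;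
       0, 0, 0, -(Real.sin θ ^ 2)⁻¹, 0]
  | 1, _ => 0
  | 4, _ => 0

theorem hasDerivAt_div_pow (c : ℝ) {t : ℝ} (n : ℕ) (ht : t ≠ 0) :
    HasDerivAt (fun s => c / s ^ n) (-(n * c / t ^ (n + 1))) t := by
  refine ((hasDerivAt_const t c).div (hasDerivAt_pow n t) (pow_ne_zero n ht)).congr_deriv ?_
  -- The power rule contains the truncated exponent `n - 1`, so `n = 0` is treated apart.
  cases n with
  | zero => simp
  | succ n =>
    simp only [Nat.add_sub_cancel]
    field_simp
    ring

theorem hasDerivAt_cot {t : ℝ} (ht : Real.sin t ≠ 0) :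
    HasDerivAt (fun s => Real.cos s / Real.sin s) (-(Real.sin t ^ 2)⁻¹) t := by
  refine ((Real.hasDerivAt_cos t).div (Real.hasDerivAt_sin t) ht).congr_deriv ?_
  field_simp
  linear_combination -Real.sin_sq_add_cos_sq t

theorem hasDerivAt_coneGamma_radial (m η θ : ℝ) {r : ℝ} (hr : r ≠ 0) (a b c : Fin 5) :
    HasDerivAt (fun t => coneGamma m a η t θ b c) (coneGammaDeriv m 2 a η r θ b c) r := by
  have d1 (c : ℝ) : HasDerivAt (fun s => c / s) (-(c / r ^ 2)) r := by
    simpa using hasDerivAt_div_pow c 1 hr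
  have h00 : HasDerivAt (fun t => η * (1 - 2 * m / t)) (η * (2 * m / r ^ 2)) r :=
    (((d1 (2 * m)).const_sub 1).const_mul η).congr_deriv (by ring)
  have h22 : HasDerivAt (fun t => m / t ^ 2 - 2 * m ^ 2 / t ^ 3)
      (-(2 * m / r ^ 3) + 6 * m ^ 2 / r ^ 4) r :=
    ((hasDerivAt_div_pow m 2 hr).sub (hasDerivAt_div_pow (2 * m ^ 2) 3 hr)).congr_deriv
      (by push_cast; ring)
  have h12 : HasDerivAt (fun t => m / t ^ 2) (-(2 * m / r ^ 3)) r :=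
    (hasDerivAt_div_pow m 2 hr).congr_deriv (by norm_num)
  have h12' : HasDerivAt (fun t => -(m / t ^ 2)) (2 * m / r ^ 3) r :=
    h12.neg.congr_deriv (by ring)
  have hsq : HasDerivAt (fun t : ℝ => t ^ 2) (2 * r) r := by simpa using hasDerivAt_pow 2 r
  have hm : HasDerivAt (fun t : ℝ => 2 * m - t) (-1) r := (hasDerivAt_id r).const_sub _
  have hinv : HasDerivAt (fun t : ℝ => 1 / t) (-(r ^ 2)⁻¹) r := by
    simpa using hasDerivAt_inv hr
  cases a using fin_five_cases <;> cases b using fin_five_cases <;> cases c using fin_five_cases <;>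
    dsimp only [coneGamma, coneGammaDeriv, Matrix.of_apply, Matrix.cons_val',
      Matrix.cons_val_fin_one, Matrix.cons_val, Matrix.zero_apply] <;>
    (try dsimp only [Matrix.cons_val]) <;>
    first
    | exact hasDerivAt_const _ _
    | exact h00
    | exact h22
    | exact h12
    | exact h12'
    | exact hinv
    | exact hm
    | exact hasDerivAt_id r
    | exact (hsq.const_mul η).neg
    | exact ((hsq.const_mul η).mul_const _).neg
    | exact ((hasDerivAt_id r).mul_const _).congr_deriv (by ring)
    | exact (hm.mul_const _).congr_deriv (by ring)

theorem hasDerivAt_coneGamma_polar (m η r : ℝ) {θ : ℝ} (hθ : Real.sin θ ≠ 0) (a b c : Fin 5) :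
    HasDerivAt (fun t => coneGamma m a η r t b c) (coneGammaDeriv m 3 a η r θ b c) θ := by
  have hsq : HasDerivAt (fun t => Real.sin t ^ 2) (2 * Real.sin θ * Real.cos θ) θ := by
    simpa using (Real.hasDerivAt_sin θ).fun_pow 2
  have hsc : HasDerivAt (fun t => -(Real.sin t * Real.cos t))
      (Real.sin θ ^ 2 - Real.cos θ ^ 2) θ :=
    ((Real.hasDerivAt_sin θ).mul (Real.hasDerivAt_cos θ)).neg.congr_deriv (by ring)
  have hcot := hasDerivAt_cot hθ
  cases a using fin_five_cases <;> cases b using fin_five_cases <;> cases c using fin_five_cases <;>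
    dsimp only [coneGamma, coneGammaDeriv, Matrix.of_apply, Matrix.cons_val',
      Matrix.cons_val_fin_one, Matrix.cons_val, Matrix.zero_apply] <;>
    (try dsimp only [Matrix.cons_val]) <;>
    first
    | exact hasDerivAt_const _ _
    | exact hcot
    | exact hsc
    | exact hsq.const_mul _
    | exact (hsq.const_mul _).neg

theorem hasDerivAt_coneGamma_base (m r θ : ℝ) {η : ℝ} (hη : η ≠ 0) (a b c : Fin 5) :
    HasDerivAt (fun t => coneGamma m a t r θ b c) (coneGammaDeriv m 0 a η r θ b c) η := by
  have hinv : HasDerivAt (fun t : ℝ => 1 / t) (-(η ^ 2)⁻¹) η := by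
    simpa using hasDerivAt_inv hη
  cases a using fin_five_cases <;> cases b using fin_five_cases <;> cases c using fin_five_cases <;>
    dsimp only [coneGamma, coneGammaDeriv, Matrix.of_apply, Matrix.cons_val',
      Matrix.cons_val_fin_one, Matrix.cons_val, Matrix.zero_apply] <;>
    (try dsimp only [Matrix.cons_val]) <;>
    first
    | exact hasDerivAt_const _ _
    | exact hinv
    | exact hasDerivAt_id η
    | exact ((hasDerivAt_id η).mul_const _).congr_deriv (by ring)
    | exact ((hasDerivAt_id η).mul_const _).neg.congr_deriv (by ring)
    | exact (((hasDerivAt_id η).mul_const _).mul_const _).neg.congr_deriv (by ring)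

theorem isOpen_regularDomain : IsOpen regularDomain := by
  have h1 : IsOpen {x : Coord 5 | x 0 ≠ 0} := isOpen_ne_fun (by fun_prop) (by fun_prop)
  have h2 : IsOpen {x : Coord 5 | x 2 ≠ 0} := isOpen_ne_fun (by fun_prop) (by fun_prop)
  have h3 : IsOpen {x : Coord 5 | Real.sin (x 3) ≠ 0} := isOpen_ne_fun (by fun_prop) (by fun_prop)
  exact h1.inter (h2.inter h3)

/-- The closed form of the Christoffel symbols is known only on `regularDomain`; openness allows it
to be differentiated there. -/
theorem pderiv_congr_of_isOpen {n : ℕ} {F H : Coord n → ℝ} {s : Set (Coord n)} (hs : IsOpen s)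
    (h : ∀ y ∈ s, F y = H y) (k : Fin n) {x : Coord n} (hx : x ∈ s) :
    pderiv k F x = pderiv k H x := by
  refine Filter.EventuallyEq.deriv_eq ?_
  have hc : ContinuousAt (fun t => Function.update x k t) (x k) :=
    (continuous_const.update k continuous_id).continuousAt
  have := hc.preimage_mem_nhds (hs.mem_nhds (by simpa using hx))
  filter_upwards [this] with t ht using h _ ht

theorem pderiv_christoffel_coneSchwarzschild (m : ℝ) (k a b c : Fin 5) {x : Coord 5}
    (hx : x ∈ regularDomain) :
    pderiv k (christoffel (coneSchwarzschild m) a b c) x =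
      coneGammaDeriv m k a (x 0) (x 2) (x 3) b c := by
  rw [pderiv_congr_of_isOpen isOpen_regularDomain
    (fun y hy => christoffel_coneSchwarzschild m a b c hy) k hx,
    pderiv_radial (fun η r θ => coneGamma m a η r θ b c) k x,
    (hasDerivAt_coneGamma_base m (x 2) (x 3) hx.1 a b c).deriv,
    (hasDerivAt_coneGamma_radial m (x 0) (x 3) hx.2.1 a b c).deriv,
    (hasDerivAt_coneGamma_polar m (x 0) (x 2) hx.2.2 a b c).deriv]
  cases k using fin_five_cases
  · rfl
  · rfl
  · rfl
  · rfl
  · rfl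

/-! ### Riemann, Ricci and Weyl tensors in block form. -/

/-- The `(u, r)` block of the metric `coneSchwarzschild m`. -/
def coneRadialBlock (m : ℝ) : Field2 5 := fun x =>
  !![0, 0, 0, 0, 0;
     0, x 0 ^ 2 * -(1 - 2 * m / x 2), -x 0 ^ 2, 0, 0;
     0, -x 0 ^ 2, 0, 0, 0;
     0, 0, 0, 0, 0;
     0, 0, 0, 0, 0]

/-- The `(θ, φ)` block of the metric `coneSchwarzschild m`. -/
def coneSphereBlock : Field2 5 := fun x =>
  !![0, 0, 0, 0, 0;
     0, 0, 0, 0, 0;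
     0, 0, 0, 0, 0;
     0, 0, 0, x 0 ^ 2 * x 2 ^ 2, 0;
     0, 0, 0, 0, x 0 ^ 2 * (x 2 ^ 2 * Real.sin (x 3) ^ 2)]

theorem riemann_swap_right {n : ℕ} (g : Field2 n) (x : Coord n) (a b c d : Fin n) :
    riemann g x a b c d = -riemann g x a b d c := by
  simp only [riemann, ← Finset.sum_neg_distrib]
  refine Finset.sum_congr rfl fun p _ => ?_
  have : ∑ q, (christoffel g q b c x * christoffel g p q d x
        - christoffel g q b d x * christoffel g p q c x) =
      -∑ q, (christoffel g q b d x * christoffel g p q c x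
        - christoffel g q b c x * christoffel g p q d x) := by
    rw [← Finset.sum_neg_distrib]
    exact Finset.sum_congr rfl fun q _ => by ring
  rw [this]
  ring

set_option maxHeartbeats 4000000 in
-- The first term is `η²` times the Schwarzschild curvature, the second the warping correction `-η²
-- (h ∧ h) / 2` of the fibre metric `h`. Both are rescaled to the blocks of the cone metric, which
-- carry the factor `η²`. Skewness in the last pair reduces the check to `c < d`.
theorem riemann_coneSchwarzschild_of_lt (m : ℝ) {x : Coord 5} (hx : x ∈ regularDomain)
    (a b c d : Fin 5) (hcd : c < d) :
    riemann (coneSchwarzschild m) x a b c d =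
      m / x 2 ^ 3 / x 0 ^ 2 * typeD (coneRadialBlock m x) (coneSphereBlock x) a b c d
      - 1 / (2 * x 0 ^ 2) * kulkarniNomizu (coneRadialBlock m x + coneSphereBlock x)
          (coneRadialBlock m x + coneSphereBlock x) a b c d := by
  simp only [riemann, pderiv_christoffel_coneSchwarzschild m _ _ _ _ hx,
    christoffel_coneSchwarzschild m _ _ _ hx, coneSchwarzschild_eq, typeD, kulkarniNomizu,
    Fin.sum_univ_five, coneRadialBlock, coneSphereBlock, Matrix.add_apply]
  obtain ⟨h0, h2, h3⟩ := hx
  generalize x 0 = η at *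
  generalize x 2 = r at *
  generalize x 3 = θ at *
  -- The Pythagorean identity is the one non-polynomial relation needed to compare the components.
  have hcos : Real.cos θ ^ 2 = 1 - Real.sin θ ^ 2 := Real.cos_sq' θ
  cases c using fin_five_cases <;> cases d using fin_five_cases <;>
    first
    | exact absurd hcd (by decide)
    | clear hcd
      cases a using fin_five_cases <;> cases b using fin_five_cases <;>
      dsimp only [coneGamma, coneGammaDeriv, Matrix.of_apply, Matrix.cons_val',
        Matrix.cons_val_fin_one, Matrix.cons_val, Matrix.zero_apply] <;>
      dsimp only [Matrix.cons_val] <;>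
      simp only [add_zero, zero_add, sub_zero, zero_sub, mul_zero, zero_mul, sub_self] <;>
      field_simp <;>
      (try ring_nf) <;>
      (try (simp only [hcos]; ring1))

/-- The factor of the type D part in the curvature of the metric `coneSchwarzschild m`. -/
def coneWeylFactor (m : ℝ) (x : Coord 5) : ℝ := m / x 2 ^ 3 / x 0 ^ 2

theorem riemann_coneSchwarzschild (m : ℝ) {x : Coord 5} (hx : x ∈ regularDomain) :
    riemann (coneSchwarzschild m) x =
      coneWeylFactor m x • typeD (coneRadialBlock m x) (coneSphereBlock x)
      - (1 / (2 * x 0 ^ 2)) • kulkarniNomizu (coneRadialBlock m x + coneSphereBlock x)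
          (coneRadialBlock m x + coneSphereBlock x) := by
  ext a b c d
  simp only [Pi.sub_apply, Pi.smul_apply, smul_eq_mul, coneWeylFactor]
  rcases lt_trichotomy c d with h | rfl | h
  · exact riemann_coneSchwarzschild_of_lt m hx a b c d h
  · have := riemann_swap_right (coneSchwarzschild m) x a b c c
    simp only [typeD, kulkarniNomizu]
    linarith
  · rw [riemann_swap_right, riemann_coneSchwarzschild_of_lt m hx a b d c h]
    simp only [typeD, kulkarniNomizu]
    ring

theorem sum_coneInv_mul (m : ℝ) (x : Coord 5) (f : Fin 5 → Fin 5 → ℝ) :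
    ∑ p, ∑ q, coneInv m x p q * f p q =
      f 0 0 - 1 / x 0 ^ 2 * (f 1 2 + f 2 1) + 1 / x 0 ^ 2 * (1 - 2 * m / x 2) * f 2 2
        + 1 / (x 0 ^ 2 * x 2 ^ 2) * f 3 3
        + 1 / (x 0 ^ 2 * (x 2 ^ 2 * Real.sin (x 3) ^ 2)) * f 4 4 := by
  simp only [Fin.sum_univ_five]
  simp [coneInv]
  ring

/-- Both blocks have rank 2, so the trace of the type D part is `2 - 2 = 0` on each. The trace of `H
∧ H` over the rank 4 form `H` is `6 H`, whence the factor `-6 / (2 η²)`. -/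
theorem ricci_coneSchwarzschild (m : ℝ) {x : Coord 5} (hx : x ∈ regularDomain) :
    ricci (coneSchwarzschild m) x =
      (-(3 / x 0 ^ 2)) • (coneRadialBlock m x + coneSphereBlock x) := by
  ext a b
  simp only [ricci, Matrix.of_apply, coneSchwarzschild_inv m hx, sum_coneInv_mul,
    riemann_coneSchwarzschild m hx, Pi.sub_apply, Pi.smul_apply, smul_eq_mul, typeD,
    kulkarniNomizu, Matrix.add_apply, Matrix.smul_apply, coneWeylFactor, coneRadialBlock,
    coneSphereBlock]
  obtain ⟨h0, h2, h3⟩ := hx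
  generalize x 0 = η at *
  generalize x 2 = r at *
  generalize x 3 = θ at *
  cases a using fin_five_cases <;> cases b using fin_five_cases <;>
    dsimp only [Matrix.of_apply, Matrix.cons_val', Matrix.cons_val_fin_one, Matrix.cons_val] <;>
    (try dsimp only [Matrix.cons_val]) <;>
    simp only [add_zero, zero_add, sub_zero, zero_sub, mul_zero, zero_mul, sub_self] <;>
    field_simp <;> ring

theorem scalarCurv_coneSchwarzschild (m : ℝ) {x : Coord 5} (hx : x ∈ regularDomain) :
    scalarCurv (coneSchwarzschild m) x = -(12 / x 0 ^ 2) := by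
  simp only [scalarCurv, coneSchwarzschild_inv m hx, sum_coneInv_mul,
    ricci_coneSchwarzschild m hx, Matrix.add_apply, Matrix.smul_apply, smul_eq_mul,
    coneRadialBlock, coneSphereBlock]
  obtain ⟨h0, h2, h3⟩ := hx
  dsimp only [Matrix.of_apply, Matrix.cons_val', Matrix.cons_val_fin_one, Matrix.cons_val]
  try dsimp only [Matrix.cons_val]
  field_simp
  ring

/-- Writing `dη²` as a product of covector components makes `dη² ∧ dη² = 0` a ring identity, as used
for the Weyl tensor. -/
theorem coneSchwarzschild_apply (m : ℝ) (x : Coord 5) (i j : Fin 5) :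
    coneSchwarzschild m x i j =
      ![1, 0, 0, 0, 0] i * ![1, 0, 0, 0, 0] j + coneRadialBlock m x i j +
        coneSphereBlock x i j := by
  rw [coneSchwarzschild_eq]
  cases i using fin_five_cases <;> cases j using fin_five_cases <;>
    simp [coneRadialBlock, coneSphereBlock]

theorem weyl_coneSchwarzschild (m : ℝ) {x : Coord 5} (hx : x ∈ regularDomain) :
    weyl (coneSchwarzschild m) x =
      coneWeylFactor m x • typeD (coneRadialBlock m x) (coneSphereBlock x) := by
  ext a b c d
  simp only [weyl, riemann_coneSchwarzschild m hx, ricci_coneSchwarzschild m hx,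
    scalarCurv_coneSchwarzschild m hx, Pi.sub_apply, Pi.smul_apply, smul_eq_mul, kulkarniNomizu,
    coneSchwarzschild_apply, Matrix.add_apply, Matrix.smul_apply]
  have h0 := hx.1
  push_cast
  field_simp
  ring

theorem isBlockPair_coneSchwarzschild (m : ℝ) {x : Coord 5} (hx : x ∈ regularDomain) :
    IsBlockPair (coneSchwarzschild m x) (coneRadialBlock m x) (coneSphereBlock x) := by
  have hinv := coneSchwarzschild_inv m hx
  obtain ⟨h0, h2, h3⟩ := hx
  have hD : coneRadialBlock m x * coneInv m x =
      Matrix.diagonal ![0, 1, 1, 0, 0] := by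
    ext i j
    simp only [coneRadialBlock, coneInv, Matrix.mul_apply, Fin.sum_univ_five]
    cases i using fin_five_cases <;> cases j using fin_five_cases <;>
      simp <;> field_simp <;> ring
  have hE : coneSphereBlock x * coneInv m x = Matrix.diagonal ![0, 0, 0, 1, 1] := by
    ext i j
    simp only [coneSphereBlock, coneInv, Matrix.mul_apply, Fin.sum_univ_five]
    cases i using fin_five_cases <;> cases j using fin_five_cases <;>
      simp <;> field_simp
  constructor
  · intro i j
    cases i using fin_five_cases <;> cases j using fin_five_cases <;> simp [coneRadialBlock]
  · intro i j
    cases i using fin_five_cases <;> cases j using fin_five_cases <;> simp [coneSphereBlock]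
  all_goals
    simp only [hinv, hD, hE]
    ext i j
    rw [Matrix.diagonal_mul]
    cases i using fin_five_cases <;> cases j using fin_five_cases <;>
      simp [coneRadialBlock, coneSphereBlock]

/-! ### The curvature conditions and their nondegeneracy. -/

theorem weylDotWeyl_coneSchwarzschild (m : ℝ) {x : Coord 5} (hx : x ∈ regularDomain) :
    weylDotWeyl (coneSchwarzschild m) x =
      (-coneWeylFactor m x ^ 2) • tachibana (coneRadialBlock m x + coneSphereBlock x)
        (typeD (coneRadialBlock m x) (coneSphereBlock x)) := by
  rw [weylDotWeyl, weyl_coneSchwarzschild m hx, curvAction_smul_left, curvAction_smul_right,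
    curvAction_typeD (isBlockPair_coneSchwarzschild m hx), smul_smul, smul_neg, neg_smul, sq]

theorem weylDotRiemann_coneSchwarzschild (m : ℝ) {x : Coord 5} (hx : x ∈ regularDomain) :
    weylDotRiemann (coneSchwarzschild m) x = weylDotWeyl (coneSchwarzschild m) x := by
  rw [weylDotRiemann, weylDotWeyl, weyl_coneSchwarzschild m hx, riemann_coneSchwarzschild m hx,
    -- Fixing `V` restricts the rewriting to the constant curvature summand, which is then
    -- annihilated.
    curvAction_sub_right, curvAction_smul_right (V := kulkarniNomizu _ _),
    curvAction_smul_left (V := kulkarniNomizu _ _),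
    curvAction_typeD_kulkarniNomizu (isBlockPair_coneSchwarzschild m hx), smul_zero, smul_zero,
    sub_zero]

theorem weylDotWeyl_eq_tachibana (m : ℝ) {x : Coord 5} (hx : x ∈ regularDomain) :
    weylDotWeyl (coneSchwarzschild m) x = (m / (3 * x 2 ^ 3)) •
      tachibana (ricci (coneSchwarzschild m) x) (weyl (coneSchwarzschild m) x) := by
  rw [weylDotWeyl_coneSchwarzschild m hx, ricci_coneSchwarzschild m hx,
    weyl_coneSchwarzschild m hx, tachibana_smul_left, tachibana_smul_right, smul_smul, smul_smul]
  -- What remains is the scalar identity `-w² = (m / (3 r³)) (-(3 / η²)) w`.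
  congr 1
  obtain ⟨h0, h2, -⟩ := hx
  rw [coneWeylFactor]
  field_simp

theorem tachibana_ricci_riemann (m : ℝ) {x : Coord 5} (hx : x ∈ regularDomain) :
    tachibana (ricci (coneSchwarzschild m) x) (riemann (coneSchwarzschild m) x) =
      tachibana (ricci (coneSchwarzschild m) x) (weyl (coneSchwarzschild m) x) := by
  have h := isBlockPair_coneSchwarzschild m hx
  have hs : ∀ i j, (coneRadialBlock m x + coneSphereBlock x) i j =
      (coneRadialBlock m x + coneSphereBlock x) j i := fun i j => by
    simp only [Matrix.add_apply, h.symm_left i j, h.symm_right i j]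
  rw [riemann_coneSchwarzschild m hx, ricci_coneSchwarzschild m hx, weyl_coneSchwarzschild m hx,
    tachibana_sub_right, tachibana_smul_right, tachibana_smul_right,
    tachibana_smul_left (V := kulkarniNomizu _ _), tachibana_kulkarniNomizu_self hs, smul_zero,
    smul_zero, sub_zero]

theorem weylDotWeyl_ne_zero {m : ℝ} (hm : m ≠ 0) {x : Coord 5} (hx : x ∈ regularDomain) :
    weylDotWeyl (coneSchwarzschild m) x ≠ 0 := by
  rw [weylDotWeyl_coneSchwarzschild m hx]
  obtain ⟨h0, h2, h3⟩ := hx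
  refine smul_ne_zero (neg_ne_zero.2 (pow_ne_zero _ ?_)) fun h => ?_
  · exact div_ne_zero (div_ne_zero hm (pow_ne_zero _ h2)) (pow_ne_zero _ h0)
  -- For the indices `(r, φ, φ, θ; u, θ)` only `H_ur T_θφφθ - H_θθ T_rφφu` survives, which is `2 + 1
  -- = 3` times `D_ur E_θθ E_φφ`.
  · have h' : tachibana (coneRadialBlock m x + coneSphereBlock x)
        (typeD (coneRadialBlock m x) (coneSphereBlock x)) 2 4 4 3 1 3 = 0 := by
      rw [h]; rfl
    simp [tachibana, typeD, kulkarniNomizu, coneRadialBlock, coneSphereBlock] at h'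
    have key : x 0 ^ 2 * (x 0 ^ 2 * x 2 ^ 2) * (x 0 ^ 2 * (x 2 ^ 2 * Real.sin (x 3) ^ 2)) = 0 := by
      -- The sign comes from `D_ur = -η²`.
      linear_combination (-1 / 3) * h'
    simp [h0, h2, h3] at key

theorem isSemiRiemannianOn_coneSchwarzschild (m : ℝ) :
    IsSemiRiemannianOn (coneSchwarzschild m) regularDomain where
  smooth i j := by
    have hd : ContDiffOn ℝ ∞ (fun x : Coord 5 => 2 * m / x 2) regularDomain :=
      contDiffOn_const.div (contDiff_apply ℝ ℝ 2).contDiffOn fun x hx => hx.2.1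
    have hs : ContDiff ℝ ∞ (fun x : Coord 5 => Real.sin (x 3)) :=
      Real.contDiff_sin.comp (contDiff_apply ℝ ℝ 3)
    have h0 : ContDiff ℝ ∞ (fun x : Coord 5 => x 0) := contDiff_apply ℝ ℝ 0
    have h2 : ContDiff ℝ ∞ (fun x : Coord 5 => x 2) := contDiff_apply ℝ ℝ 2
    simp only [coneSchwarzschild_eq]
    cases i using fin_five_cases <;> cases j using fin_five_cases <;>
      dsimp only [Matrix.of_apply, Matrix.cons_val', Matrix.cons_val_fin_one, Matrix.cons_val] <;>
      first
      | exact contDiffOn_const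
      | exact ((h0.pow 2).contDiffOn).mul (contDiffOn_const.sub hd).neg
      | exact ((h0.pow 2).mul contDiff_const).contDiffOn
      | exact ((h0.pow 2).mul (h2.pow 2)).contDiffOn
      | exact ((h0.pow 2).mul ((h2.pow 2).mul (hs.pow 2))).contDiffOn
  symm x hx := by
    have h := isBlockPair_coneSchwarzschild m hx
    ext i j
    rw [Matrix.transpose_apply, coneSchwarzschild_apply, coneSchwarzschild_apply,
      h.symm_left j i, h.symm_right j i, mul_comm (![1, 0, 0, 0, 0] j)]
  nondegenerate x hx :=
    (Matrix.isUnit_det_of_right_inverse (coneSchwarzschild_mul_coneInv m hx)).ne_zero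

theorem IsSemiRiemannianOn.mono {n : ℕ} {g : Field2 n} {U V : Set (Coord n)}
    (h : IsSemiRiemannianOn g V) (hUV : U ⊆ V) : IsSemiRiemannianOn g U :=
  ⟨fun i j => (h.smooth i j).mono hUV, fun x hx => h.symm x (hUV hx),
    fun x hx => h.nondegenerate x (hUV hx)⟩

end

end CurvCond

theorem mainTheorem4 (m : ℝ) (U : Set (CurvCond.Coord 5)) (hUo : IsOpen U)
    (hUn : U.Nonempty) (hU : U ⊆ CurvCond.regularDomain) :
    CurvCond.IsSemiRiemannianOn (CurvCond.coneSchwarzschild m) U ∧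
    (∀ x ∈ U, CurvCond.weylDotRiemann (CurvCond.coneSchwarzschild m) x =
      (m / (3 * x 2 ^ 3)) •
        CurvCond.tachibana (CurvCond.ricci (CurvCond.coneSchwarzschild m) x)
          (CurvCond.riemann (CurvCond.coneSchwarzschild m) x)) ∧
    (∀ x ∈ U, CurvCond.weylDotWeyl (CurvCond.coneSchwarzschild m) x =
      (m / (3 * x 2 ^ 3)) •
        CurvCond.tachibana (CurvCond.ricci (CurvCond.coneSchwarzschild m) x)
          (CurvCond.weyl (CurvCond.coneSchwarzschild m) x)) ∧
    (m ≠ 0 →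
      (∀ x ∈ U, CurvCond.weylDotRiemann (CurvCond.coneSchwarzschild m) x ≠ 0) ∧
      (∀ x ∈ U, CurvCond.weylDotWeyl (CurvCond.coneSchwarzschild m) x ≠ 0) ∧
      ¬ CurvCond.HasSemisymmetricWeyl (CurvCond.coneSchwarzschild m) U ∧
      CurvCond.IsProperlyRicciGenPseudosymmetricDueToWeyl (CurvCond.coneSchwarzschild m) U ∧
      CurvCond.HasRicciGenPseudosymmetricWeyl (CurvCond.coneSchwarzschild m) U) := by
  have hR : ∀ x ∈ U, CurvCond.weylDotRiemann (CurvCond.coneSchwarzschild m) x =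
      (m / (3 * x 2 ^ 3)) •
        CurvCond.tachibana (CurvCond.ricci (CurvCond.coneSchwarzschild m) x)
          (CurvCond.riemann (CurvCond.coneSchwarzschild m) x) := fun x hx => by
    rw [CurvCond.weylDotRiemann_coneSchwarzschild m (hU hx),
      CurvCond.tachibana_ricci_riemann m (hU hx), CurvCond.weylDotWeyl_eq_tachibana m (hU hx)]
  have hC := fun x hx => CurvCond.weylDotWeyl_eq_tachibana m (x := x) (hU hx)
  have hf : ContDiffOn ℝ (↑(⊤ : ℕ∞)) (fun x : CurvCond.Coord 5 => m / (3 * x 2 ^ 3)) U :=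
    contDiffOn_const.div (contDiff_const.mul ((contDiff_apply ℝ ℝ 2).pow 3)).contDiffOn
      fun x hx => mul_ne_zero three_ne_zero (pow_ne_zero 3 (hU hx).2.1)
  refine ⟨(CurvCond.isSemiRiemannianOn_coneSchwarzschild m).mono hU, hR, hC, fun hm => ?_⟩
  have hC0 : ∀ x ∈ U, CurvCond.weylDotWeyl (CurvCond.coneSchwarzschild m) x ≠ 0 :=
    fun x hx => CurvCond.weylDotWeyl_ne_zero hm (hU hx)
  have hR0 : ∀ x ∈ U, CurvCond.weylDotRiemann (CurvCond.coneSchwarzschild m) x ≠ 0 :=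
    fun x hx => CurvCond.weylDotRiemann_coneSchwarzschild m (hU hx) ▸ hC0 x hx
  -- Nonvanishing holds at every point, so any single point of `U` refutes both vanishing
  -- conditions.
  obtain ⟨y, hy⟩ := hUn
  exact ⟨hR0, hC0, fun h => hC0 y hy (h y hy), ⟨⟨_, hf, hR⟩, fun h => hR0 y hy (h y hy)⟩,
    ⟨_, hf, hC⟩⟩
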